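/- For a complex order $\nu$ let $j_\nu(z)=\sum_{k=0}^\infty \frac{(-1)^k}{k!\,\Gamma(k+\nu+1)}\left(\frac z2\right)^{2k}$ be the normalized Bessel function, so that $j_\nu(z)=(z/2)^{-\nu}J_\nu(z)$; it is an entire function of $z$. A nonzero complex number $z$ is called $j_\nu$-rational if $z=a/b$ where $a$ and $b$ are zeros of $j_\nu$ and $b\neq 0$. A complex number $z$ is called $j_\nu$-Liouville if it is not $j_\nu$-rational and for every $N\in\mathbb N$ there are zeros $a,b$ of $j_\nu$ with $|b|>1$ and $|z-a/b|<1/|b|^N$. Corollary. Suppose that $\nu\in\mathbb C$ is not real. Then there are no $j_\nu$-Liouville numbers. Moreover, if $r,s>0$ are real numbers such that $r/s$ is not $j_\nu$-rational, then there is a constant $d>0$ (depending on $r$, $s$ and $\nu$) such that $\left|\frac ar-\frac bs\right|\ge d$ for all zeros $a,b$ of $j_\nu$. -/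

import Mathlib

/-- The normalized Bessel function `j_ν(z) = (z/2)^{-ν} J_ν(z)` of complex order `ν`, given by its
everywhere convergent power series (`normalizedBessel_summable`). -/
noncomputable def normalizedBessel (ν z : ℂ) : ℂ :=
  ∑' k : ℕ, (-1 : ℂ) ^ k / ((Nat.factorial k : ℂ) * Complex.Gamma ((k : ℂ) + ν + 1))
    * (z / 2) ^ (2 * k)

/-- The series defining `j_ν(z)` converges for all complex `ν` and `z`. -/
theorem normalizedBessel_summable (ν z : ℂ) :
    Summable (fun k : ℕ => (-1 : ℂ) ^ k /
      ((Nat.factorial k : ℂ) * Complex.Gamma ((k : ℂ) + ν + 1)) * (z / 2) ^ (2 * k)) := by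
  obtain ⟨M, hM⟩ := exists_nat_gt (‖ν‖ + ‖z / 2‖ ^ 2 + 1)
  refine summable_of_ratio_norm_eventually_le (r := 1 / 2) (by norm_num) ?_
  filter_upwards [Filter.eventually_ge_atTop (M + 1)] with k hk
  have hkM : (M : ℝ) + 1 ≤ k := by exact_mod_cast hk
  have h1 : ‖z / 2‖ ^ 2 + 1 ≤ ‖(k : ℂ) + ν + 1‖ := by
    have h := norm_sub_le ((k : ℂ) + ν + 1) (ν + 1)
    have h' : ‖ν + 1‖ ≤ ‖ν‖ + 1 := by simpa using norm_add_le ν 1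
    have e : (k : ℂ) + ν + 1 - (ν + 1) = k := by ring
    rw [e, Complex.norm_natCast] at h
    linarith
  have hpos : 0 < ‖(k : ℂ) + ν + 1‖ := by nlinarith [sq_nonneg ‖z / 2‖]
  have hne : (k : ℂ) + ν + 1 ≠ 0 := norm_pos_iff.mp hpos
  have hG : Complex.Gamma (((k + 1 : ℕ) : ℂ) + ν + 1) =
      ((k : ℂ) + ν + 1) * Complex.Gamma ((k : ℂ) + ν + 1) := by
    rw [← Complex.Gamma_add_one _ hne]; push_cast; ring_nf
  have hk1 : (2 : ℝ) ≤ (k : ℝ) + 1 := by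
    have : (0 : ℝ) ≤ M := Nat.cast_nonneg M
    linarith
  have e : (-1 : ℂ) ^ (k + 1) / ((Nat.factorial (k + 1) : ℂ) *
      Complex.Gamma (((k + 1 : ℕ) : ℂ) + ν + 1)) * (z / 2) ^ (2 * (k + 1)) =
      (-((z / 2) ^ 2 / (((k : ℂ) + 1) * ((k : ℂ) + ν + 1)))) * ((-1 : ℂ) ^ k /
      ((Nat.factorial k : ℂ) * Complex.Gamma ((k : ℂ) + ν + 1)) * (z / 2) ^ (2 * k)) := by
    rw [hG, Nat.factorial_succ]
    push_cast
    simp only [div_eq_mul_inv, mul_inv]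
    ring
  rw [e, norm_mul]
  refine mul_le_mul_of_nonneg_right ?_ (norm_nonneg _)
  have hk2 : ‖(k : ℂ) + 1‖ = (k : ℝ) + 1 := by
    rw [← Nat.cast_succ, Complex.norm_natCast]; push_cast; ring
  rw [norm_neg, norm_div, norm_mul, norm_pow, hk2, div_le_iff₀ (by positivity)]
  nlinarith

/-- `a` is a zero of `j_ν`. -/
def IsBesselZero (ν a : ℂ) : Prop := normalizedBessel ν a = 0

/-- A nonzero complex number is `j_ν`-rational if it is the ratio `a / b` of two zeros of `j_ν`,
with `b ≠ 0`. -/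
def IsBesselRational (ν z : ℂ) : Prop :=
  z ≠ 0 ∧ ∃ a b : ℂ, IsBesselZero ν a ∧ IsBesselZero ν b ∧ b ≠ 0 ∧ z = a / b

/-- A complex number `z` is `j_ν`-Liouville if it is not `j_ν`-rational and for every `N` there are
zeros `a`, `b` of `j_ν` with `|b| > 1` and `|z - a / b| < 1 / |b| ^ N`. -/
def IsBesselLiouville (ν z : ℂ) : Prop :=
  ¬ IsBesselRational ν z ∧
    ∀ N : ℕ, ∃ a b : ℂ, IsBesselZero ν a ∧ IsBesselZero ν b ∧ 1 < ‖b‖ ∧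
      ‖z - a / b‖ < 1 / ‖b‖ ^ N

/-! For nonreal `ν` the zeros of `j_ν` are discrete and have imaginary parts tending to `±π |Im ν| /
2`. Both claims follow from this.

To locate the zeros, put `u = z^(ν+1/2) j_ν`, which solves `u'' = (q/z² - 1) u` with `q = ν² - 1/4`,
and split `e^{iz} u` into amplitudes `A + b`. Since `q/z²` is integrable towards infinity, Grönwall
makes `A` almost constant far out in the upper half plane, while `|b|` decays like `e^{-2y}` with
the height `y`. Continuation of `z^(ν+1/2)` from `x` to `-x` swaps the two amplitudes up to a factor
of modulus `ℓ = e^{-π Im ν}`. As `A` has nearly the same value at `x` and `-x`, this forces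
`|b|/|A|` towards `1/ℓ` on the right half line and `ℓ` on the left. A zero needs `|A| = |b|`, so
`2y` is close to `|log ℓ| = π |Im ν|` (`exists_abs_two_mul_sub_abs_log_lt`). Evenness of `j_ν`
covers the lower half plane.

If `z` is Liouville, discreteness yields zeros with `|b| → ∞` and `z b - a → 0`. Bounded imaginary
parts force `z` to be real, and their common limiting modulus forces `|z| = 1`; but `±1` is rational
because the zeros are symmetric. For `a/r - b/s`, large zeros are separated by their imaginary parts
when `r ≠ s`, and bounded zeros by finiteness. -/

/-- Weighted Grönwall inequality for a pair of functions, one of which may be damped. -/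
theorem normSq_add_le_exp_mul {a b a' b' : ℝ → ℂ} {κ : ℂ} {K t₀ t₁ : ℝ} (ht : t₀ ≤ t₁)
    (hκ : κ.re ≤ 0)
    (ha : ∀ t ∈ Set.Icc t₀ t₁, HasDerivAt a (a' t) t)
    (hb : ∀ t ∈ Set.Icc t₀ t₁, HasDerivAt b (κ * b t + b' t) t)
    (ha' : ∀ t ∈ Set.Icc t₀ t₁, ‖a' t‖ ≤ K / (1 + t ^ 2) * (‖a t‖ + ‖b t‖))
    (hb' : ∀ t ∈ Set.Icc t₀ t₁, ‖b' t‖ ≤ K / (1 + t ^ 2) * (‖a t‖ + ‖b t‖)) (hK : 0 ≤ K) :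
    ‖a t₁‖ ^ 2 + ‖b t₁‖ ^ 2 ≤ Real.exp (4 * K * Real.pi) * (‖a t₀‖ ^ 2 + ‖b t₀‖ ^ 2) := by
  set N : ℝ → ℝ := fun t => ‖a t‖ ^ 2 + ‖b t‖ ^ 2 with hN
  -- Integrating factor: `arctan` is a primitive of `1/(1+t²)`, and its total variation is at most
  -- `π`, so the final constant does not depend on the interval. The 4 comes from `2(|a|+|b|)² ≤
  -- 4(|a|²+|b|²)`.
  set E : ℝ → ℝ := fun t => Real.exp (-(4 * K * Real.arctan t)) with hE
  have hNd : ∀ t ∈ Set.Icc t₀ t₁, HasDerivAt N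
      (2 * inner ℝ (a t) (a' t) + 2 * inner ℝ (b t) (κ * b t + b' t)) t := fun t h =>
    (ha t h).norm_sq.add (hb t h).norm_sq
  have hEd : ∀ t, HasDerivAt E (E t * -(4 * K * (1 / (1 + t ^ 2)))) t := fun t =>
    (((Real.hasDerivAt_arctan t).const_mul (4 * K)).neg).exp
  have hd : ∀ t ∈ Set.Icc t₀ t₁, HasDerivAt (fun t => E t * N t)
      (E t * -(4 * K * (1 / (1 + t ^ 2))) * N t + E t *
        (2 * inner ℝ (a t) (a' t) + 2 * inner ℝ (b t) (κ * b t + b' t))) t := fun t h =>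
    (hEd t).mul (hNd t h)
  have hanti : AntitoneOn (fun t => E t * N t) (Set.Icc t₀ t₁) := by
    refine antitoneOn_of_deriv_nonpos (convex_Icc _ _)
      (fun t h => (hd t h).continuousAt.continuousWithinAt)
      (fun t h => (hd t (interior_subset h)).differentiableAt.differentiableWithinAt) ?_
    intro t h
    have h := interior_subset h
    rw [(hd t h).deriv]
    have h1 : inner ℝ (a t) (a' t) ≤ ‖a t‖ * ‖a' t‖ := real_inner_le_norm _ _
    have h2 : inner ℝ (b t) (b' t) ≤ ‖b t‖ * ‖b' t‖ := real_inner_le_norm _ _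
    have h3 : inner ℝ (b t) (κ * b t) ≤ 0 := by
      have : inner ℝ (b t) (κ * b t) = κ.re * ‖b t‖ ^ 2 := by
        rw [← Complex.normSq_eq_norm_sq, Complex.normSq_apply]
        simp [Complex.inner, Complex.mul_re, Complex.mul_im]; ring
      rw [this]
      exact mul_nonpos_of_nonpos_of_nonneg hκ (by positivity)
    rw [inner_add_right]
    set k := K / (1 + t ^ 2) with hk
    have hk0 : 0 ≤ k := by positivity
    have e : 4 * K * (1 / (1 + t ^ 2)) = 4 * k := by rw [hk]; ring
    rw [e]
    have h4 : ‖a t‖ * ‖a' t‖ ≤ ‖a t‖ * (k * (‖a t‖ + ‖b t‖)) :=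
      mul_le_mul_of_nonneg_left (ha' t h) (norm_nonneg _)
    have h5 : ‖b t‖ * ‖b' t‖ ≤ ‖b t‖ * (k * (‖a t‖ + ‖b t‖)) :=
      mul_le_mul_of_nonneg_left (hb' t h) (norm_nonneg _)
    have h6 : 0 ≤ k * (‖a t‖ - ‖b t‖) ^ 2 := by positivity
    have h7 : -(4 * k) * N t + (2 * inner ℝ (a t) (a' t) + 2 * (inner ℝ (b t) (κ * b t)
        + inner ℝ (b t) (b' t))) ≤ 0 := by
      simp only [hN]; nlinarith
    have h8 : 0 ≤ E t := (Real.exp_pos _).le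
    nlinarith [mul_nonpos_of_nonneg_of_nonpos h8 h7]
  have hmain := hanti (Set.left_mem_Icc.2 ht) (Set.right_mem_Icc.2 ht) ht
  simp only at hmain
  have hN0 : ∀ t, 0 ≤ N t := fun t => by simp only [hN]; positivity
  have e1 : Real.exp (-(2 * K * Real.pi)) ≤ E t₁ := by
    apply Real.exp_le_exp.2
    nlinarith [Real.arctan_lt_pi_div_two t₁]
  have e2 : E t₀ ≤ Real.exp (2 * K * Real.pi) := by
    apply Real.exp_le_exp.2
    nlinarith [Real.neg_pi_div_two_lt_arctan t₀]
  have h9 : Real.exp (-(2 * K * Real.pi)) * N t₁ ≤ Real.exp (2 * K * Real.pi) * N t₀ :=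
    (mul_le_mul_of_nonneg_right e1 (hN0 _)).trans
      (hmain.trans (mul_le_mul_of_nonneg_right e2 (hN0 _)))
  have h10 : N t₁ = Real.exp (2 * K * Real.pi) * (Real.exp (-(2 * K * Real.pi)) * N t₁) := by
    rw [← mul_assoc, ← Real.exp_add]; simp
  change N t₁ ≤ Real.exp (4 * K * Real.pi) * N t₀
  have h11 : Real.exp (4 * K * Real.pi) =
      Real.exp (2 * K * Real.pi) * Real.exp (2 * K * Real.pi) := by
    rw [← Real.exp_add]; ring_nf
  rw [h10, h11, mul_assoc (Real.exp _)]
  exact mul_le_mul_of_nonneg_left h9 (Real.exp_pos _).le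

/-! ### Amplitude pairs and their boundedness -/

/-- The amplitudes `A = e^{iz}(u + i u') / 2` and `b = e^{iz}(u - i u') / 2` of a solution of
`u'' = (q / z² - 1) u` on the punctured closed upper half plane whose values at `x` and `-x` are
proportional with a factor of modulus `ℓ`. -/
structure AmplitudePair (q : ℂ) (ℓ : ℝ) (A b : ℂ → ℂ) : Prop where
  hasDerivAt_fst : ∀ z : ℂ, 0 ≤ z.im → z ≠ 0 →
    HasDerivAt A (Complex.I * q / (2 * z ^ 2) * (A z + b z)) z
  hasDerivAt_snd : ∀ z : ℂ, 0 ≤ z.im → z ≠ 0 →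
    HasDerivAt b (2 * Complex.I * b z - Complex.I * q / (2 * z ^ 2) * (A z + b z)) z
  factor_pos : 0 < ℓ
  norm_fst_neg : ∀ x : ℝ, 0 < x → ‖A (-x)‖ = ℓ * ‖b x‖
  norm_snd_neg : ∀ x : ℝ, 0 < x → ‖b (-x)‖ = ℓ * ‖A x‖

namespace AmplitudePair

variable {q : ℂ} {ℓ : ℝ} {A b : ℂ → ℂ}

/-- The unit factor `c` absorbs the direction of the path, so one estimate serves horizontal and
vertical segments. -/
theorem norm_coeff_le {q z w c : ℂ} (hc : ‖c‖ = 1) {r : ℝ} (hr : 0 < r) (hz : r ≤ ‖z‖ ^ 2) :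
    ‖c * (Complex.I * q / (2 * z ^ 2) * w)‖ ≤ ‖q‖ / 2 / r * ‖w‖ := by
  rw [norm_mul, hc, one_mul, norm_mul, norm_div, norm_mul, norm_mul, norm_pow, Complex.norm_I,
    one_mul, Complex.norm_two, div_div]
  gcongr

theorem norm_sq_add_mul_I (x y : ℝ) : ‖(x + y * Complex.I : ℂ)‖ ^ 2 = x ^ 2 + y ^ 2 := by
  rw [← Complex.normSq_eq_norm_sq, Complex.normSq_add_mul_I]

theorem add_mul_I_ne_zero {x y : ℝ} (h : 0 < x ^ 2 + y ^ 2) : (x + y * Complex.I : ℂ) ≠ 0 := by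
  intro h0
  have := norm_sq_add_mul_I x y
  rw [h0] at this
  simp at this
  linarith

theorem hasDerivAt_horizontal {f : ℂ → ℂ} {f' : ℂ} (y x : ℝ)
    (h : HasDerivAt f f' (x + y * Complex.I)) :
    HasDerivAt (fun t : ℝ => f (t + y * Complex.I)) f' x := by
  have h1 : HasDerivAt (fun t : ℝ => (t + y * Complex.I : ℂ)) 1 x :=
    (Complex.ofRealCLM.hasDerivAt (x := x)).add_const _
  simpa [Function.comp_def] using HasDerivAt.comp x h h1

theorem hasDerivAt_vertical {f : ℂ → ℂ} {f' : ℂ} (x y : ℝ)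
    (h : HasDerivAt f f' (x + y * Complex.I)) :
    HasDerivAt (fun t : ℝ => f (x + t * Complex.I)) (Complex.I * f') y := by
  have h1 : HasDerivAt (fun t : ℝ => (x + t * Complex.I : ℂ)) (1 * Complex.I) y :=
    ((Complex.ofRealCLM.hasDerivAt (x := y)).mul_const _).const_add _
  refine (HasDerivAt.comp y h h1).congr_deriv ?_
  ring

/-- Along a horizontal line the term `2ib` is a rotation and does not change `|b|`. The condition on
`x₀` and `y` keeps the path away from the singularity at 0. -/
theorem normSq_right_le (h : AmplitudePair q ℓ A b) {y x₀ x₁ : ℝ} (hy : 0 ≤ y) (hx : x₀ ≤ x₁)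
    (hxy : 1 ≤ x₀ ∨ 1 ≤ y) :
    ‖A (x₁ + y * Complex.I)‖ ^ 2 + ‖b (x₁ + y * Complex.I)‖ ^ 2 ≤ Real.exp (4 * ‖q‖ * Real.pi) *
      (‖A (x₀ + y * Complex.I)‖ ^ 2 + ‖b (x₀ + y * Complex.I)‖ ^ 2) := by
  have key : ∀ t ∈ Set.Icc x₀ x₁, (1 + t ^ 2) / 2 ≤ t ^ 2 + y ^ 2 := by
    rintro t ⟨h1, h2⟩
    rcases hxy with h3 | h3 <;> nlinarith [sq_nonneg y, sq_nonneg t]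
  have hne : ∀ t ∈ Set.Icc x₀ x₁, (t + y * Complex.I : ℂ) ≠ 0 := fun t ht =>
    add_mul_I_ne_zero (lt_of_lt_of_le (by positivity) (key t ht))
  have hest : ∀ t ∈ Set.Icc x₀ x₁, ∀ c : ℂ, ‖c‖ = 1 →
      ‖c * (Complex.I * q / (2 * (t + y * Complex.I) ^ 2) *
        (A (t + y * Complex.I) + b (t + y * Complex.I)))‖ ≤
      ‖q‖ / (1 + t ^ 2) * (‖A (t + y * Complex.I)‖ + ‖b (t + y * Complex.I)‖) := by
    intro t ht c hc
    refine (norm_coeff_le hc (r := (1 + t ^ 2) / 2) (by positivity) ?_).trans ?_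
    · rw [norm_sq_add_mul_I]; exact key t ht
    · rw [div_div_div_cancel_right₀ two_ne_zero]
      exact mul_le_mul_of_nonneg_left (norm_add_le _ _) (by positivity)
  refine normSq_add_le_exp_mul (κ := 2 * Complex.I) (a := fun t : ℝ => A (t + y * Complex.I))
    (b := fun t : ℝ => b (t + y * Complex.I)) hx (by simp)
    (fun t ht => hasDerivAt_horizontal y t (h.hasDerivAt_fst _ (by simpa using hy) (hne t ht)))
    (b' := fun t : ℝ => -(Complex.I * q / (2 * (t + y * Complex.I) ^ 2) *
        (A (t + y * Complex.I) + b (t + y * Complex.I))))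
    (fun t ht => by
      simpa [sub_eq_add_neg] using
        hasDerivAt_horizontal y t (h.hasDerivAt_snd _ (by simpa using hy) (hne t ht)))
    (fun t ht => by simpa using hest t ht 1 (by simp))
    (fun t ht => by simpa using hest t ht 1 (by simp)) (norm_nonneg _)

/-- A rotation run backwards is still a rotation, so the horizontal estimate is reversible; this
later supplies lower bounds. -/
theorem normSq_left_le (h : AmplitudePair q ℓ A b) {y x₀ x₁ : ℝ} (hy : 0 ≤ y) (hx : x₀ ≤ x₁)
    (hxy : 1 ≤ x₀ ∨ 1 ≤ y) :
    ‖A (x₀ + y * Complex.I)‖ ^ 2 + ‖b (x₀ + y * Complex.I)‖ ^ 2 ≤ Real.exp (4 * ‖q‖ * Real.pi) *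
      (‖A (x₁ + y * Complex.I)‖ ^ 2 + ‖b (x₁ + y * Complex.I)‖ ^ 2) := by
  have key : ∀ t ∈ Set.Icc (-x₁) (-x₀), (1 + t ^ 2) / 2 ≤ (-t) ^ 2 + y ^ 2 := by
    rintro t ⟨h1, h2⟩
    rcases hxy with h3 | h3 <;> nlinarith [sq_nonneg y, sq_nonneg t]
  have hne : ∀ t ∈ Set.Icc (-x₁) (-x₀), ((-t : ℝ) + y * Complex.I : ℂ) ≠ 0 := fun t ht =>
    add_mul_I_ne_zero (lt_of_lt_of_le (by positivity) (key t ht))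
  have hest : ∀ t ∈ Set.Icc (-x₁) (-x₀),
      ‖Complex.I * q / (2 * ((-t : ℝ) + y * Complex.I) ^ 2) *
        (A ((-t : ℝ) + y * Complex.I) + b ((-t : ℝ) + y * Complex.I))‖ ≤
      ‖q‖ / (1 + t ^ 2) * (‖A ((-t : ℝ) + y * Complex.I)‖ + ‖b ((-t : ℝ) + y * Complex.I)‖) := by
    intro t ht
    have := norm_coeff_le (q := q) (z := ((-t : ℝ) + y * Complex.I))
      (w := A ((-t : ℝ) + y * Complex.I) + b ((-t : ℝ) + y * Complex.I)) norm_one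
      (r := (1 + t ^ 2) / 2) (by positivity)
      (by rw [norm_sq_add_mul_I]; exact key t ht)
    rw [one_mul] at this
    refine this.trans ?_
    rw [div_div_div_cancel_right₀ two_ne_zero]
    exact mul_le_mul_of_nonneg_left (norm_add_le _ _) (by positivity)
  have := normSq_add_le_exp_mul (κ := -2 * Complex.I)
    (a := fun t : ℝ => A ((-t : ℝ) + y * Complex.I))
    (b := fun t : ℝ => b ((-t : ℝ) + y * Complex.I)) (neg_le_neg hx) (by simp)
    (a' := fun t : ℝ => -(Complex.I * q / (2 * ((-t : ℝ) + y * Complex.I) ^ 2) *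
        (A ((-t : ℝ) + y * Complex.I) + b ((-t : ℝ) + y * Complex.I))))
    (fun t ht => by
      have h1 := hasDerivAt_horizontal y (-t)
        (h.hasDerivAt_fst _ (by simpa using hy) (hne t ht))
      simpa [Function.comp_def] using HasDerivAt.scomp t h1 (hasDerivAt_neg t))
    (b' := fun t : ℝ => Complex.I * q / (2 * ((-t : ℝ) + y * Complex.I) ^ 2) *
        (A ((-t : ℝ) + y * Complex.I) + b ((-t : ℝ) + y * Complex.I)))
    (fun t ht => by
      have h1 := hasDerivAt_horizontal y (-t)
        (h.hasDerivAt_snd _ (by simpa using hy) (hne t ht))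
      have h2 := HasDerivAt.scomp t h1 (hasDerivAt_neg t)
      refine h2.congr_deriv ?_
      rw [neg_one_smul]; ring)
    (fun t ht => by rw [norm_neg]; exact hest t ht)
    (fun t ht => hest t ht) (norm_nonneg q)
  simpa using this

/-- Going up turns `2ib` into the damping term `-2b`; hence the estimate holds upwards only. -/
theorem normSq_up_le (h : AmplitudePair q ℓ A b) {x y : ℝ} (hy : 0 ≤ y) (hx : 1 ≤ x ^ 2) :
    ‖A (x + y * Complex.I)‖ ^ 2 + ‖b (x + y * Complex.I)‖ ^ 2 ≤ Real.exp (4 * ‖q‖ * Real.pi) *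
      (‖A x‖ ^ 2 + ‖b x‖ ^ 2) := by
  have key : ∀ t : ℝ, (1 + t ^ 2) / 2 ≤ x ^ 2 + t ^ 2 := by
    intro t; nlinarith [sq_nonneg t]
  have hne : ∀ t : ℝ, (x + t * Complex.I : ℂ) ≠ 0 := fun t =>
    add_mul_I_ne_zero (lt_of_lt_of_le (by positivity) (key t))
  have hest : ∀ t : ℝ, ∀ c : ℂ, ‖c‖ = 1 →
      ‖c * (Complex.I * q / (2 * (x + t * Complex.I) ^ 2) *
        (A (x + t * Complex.I) + b (x + t * Complex.I)))‖ ≤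
      ‖q‖ / (1 + t ^ 2) * (‖A (x + t * Complex.I)‖ + ‖b (x + t * Complex.I)‖) := by
    intro t c hc
    refine (norm_coeff_le hc (r := (1 + t ^ 2) / 2) (by positivity) ?_).trans ?_
    · rw [norm_sq_add_mul_I]; exact key t
    · rw [div_div_div_cancel_right₀ two_ne_zero]
      exact mul_le_mul_of_nonneg_left (norm_add_le _ _) (by positivity)
  have := normSq_add_le_exp_mul (κ := -2) (a := fun t : ℝ => A (x + t * Complex.I))
    (b := fun t : ℝ => b (x + t * Complex.I)) hy (by simp)
    (fun t ht => hasDerivAt_vertical x t (h.hasDerivAt_fst _ (by simpa using ht.1) (hne t)))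
    (b' := fun t : ℝ => (-Complex.I) * (Complex.I * q / (2 * (x + t * Complex.I) ^ 2) *
        (A (x + t * Complex.I) + b (x + t * Complex.I))))
    (fun t ht => by
      refine (hasDerivAt_vertical x t
        (h.hasDerivAt_snd _ (by simpa using ht.1) (hne t))).congr_deriv ?_
      linear_combination 2 * b (x + t * Complex.I) * Complex.I_mul_I)
    (fun t ht => hest t _ (by simp))
    (fun t ht => hest t _ (by simp)) (norm_nonneg _)
  simpa using this

/-- The amplitudes are bounded away from the origin. -/
theorem exists_bound (h : AmplitudePair q ℓ A b) : ∃ M : ℝ, 0 < M ∧ ∀ x y : ℝ, 0 ≤ y →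
    (1 ≤ |x| ∨ 1 ≤ y) → ‖A (x + y * Complex.I)‖ + ‖b (x + y * Complex.I)‖ ≤ M := by
  set N : ℂ → ℝ := fun z => ‖A z‖ ^ 2 + ‖b z‖ ^ 2 with hN
  have hN0 : ∀ z, 0 ≤ N z := fun z => by simp only [hN]; positivity
  set E := Real.exp (4 * ‖q‖ * Real.pi) with hE
  have hE0 : 0 < E := Real.exp_pos _
  have hE1 : 1 ≤ E := Real.one_le_exp (by positivity)
  -- The bound spreads from the point 1 to `[1, ∞)`, by reflection to `(-∞, -1]`, upwards over `|x|
  -- ≥ 1`, and sideways from `x = 1` into the remaining strip at heights at least 1.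
  have h1 : ∀ x : ℝ, 1 ≤ x → N x ≤ E * N 1 := fun x hx => by
    simpa using h.normSq_right_le (y := 0) le_rfl hx (Or.inl le_rfl)
  have h2 : ∀ x : ℝ, 1 ≤ x → N (-x) ≤ ℓ ^ 2 * (E * N 1) := fun x hx => by
    have : N (-x) = ℓ ^ 2 * N x := by
      simp only [hN]
      rw [h.norm_fst_neg x (by linarith), h.norm_snd_neg x (by linarith)]; ring
    rw [this]
    exact mul_le_mul_of_nonneg_left (h1 x hx) (by positivity)
  set P := (1 + ℓ ^ 2) * (E * N 1) with hP
  have hEN : 0 ≤ E * N 1 := mul_nonneg hE0.le (hN0 1)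
  have h3 : ∀ x : ℝ, 1 ≤ |x| → N x ≤ P := by
    intro x hx
    rcases le_abs.1 hx with h4 | h4
    · exact (h1 x h4).trans (by rw [hP]; nlinarith [mul_nonneg (sq_nonneg ℓ) hEN])
    · have := h2 (-x) h4
      rw [Complex.ofReal_neg, neg_neg] at this
      exact this.trans (by rw [hP]; nlinarith)
  have hP0 : 0 ≤ P := (hN0 1).trans (by simpa using h3 1 (by simp))
  have h4 : ∀ x y : ℝ, 0 ≤ y → 1 ≤ |x| → N (x + y * Complex.I) ≤ E * P := by
    intro x y hy hx
    refine (h.normSq_up_le hy ?_).trans (mul_le_mul_of_nonneg_left (h3 x hx) hE0.le)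
    rw [← sq_abs]; nlinarith
  have h5 : ∀ x y : ℝ, 0 ≤ y → (1 ≤ |x| ∨ 1 ≤ y) → N (x + y * Complex.I) ≤ E * (E * P) := by
    intro x y hy hxy
    by_cases hx : 1 ≤ |x|
    · exact (h4 x y hy hx).trans (le_mul_of_one_le_left (by positivity) hE1)
    · have hx1 : x ≤ 1 := (le_abs_self x).trans (not_le.1 hx).le
      exact (h.normSq_left_le hy hx1 (Or.inr (hxy.resolve_left hx))).trans
        (mul_le_mul_of_nonneg_left (h4 1 y hy (by simp)) hE0.le)
  refine ⟨E * (E * P) + 2, by positivity, fun x y hy hxy => ?_⟩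
  have := h5 x y hy hxy
  simp only [hN] at this
  nlinarith [sq_nonneg (‖A (x + y * Complex.I)‖ - 1), sq_nonneg (‖b (x + y * Complex.I)‖ - 1)]

end AmplitudePair

/-! ### Asymptotics of the amplitudes and location of the zeros -/

namespace AmplitudePair

variable {q : ℂ} {ℓ : ℝ} {A b : ℂ → ℂ}

/-- The variation of the amplitudes along horizontal and vertical segments is of the order of the
length divided by the squared distance to the origin. -/
theorem exists_variation_bound (h : AmplitudePair q ℓ A b) : ∃ C : ℝ, 0 < C ∧
    (∀ x y : ℝ, 0 ≤ y → (1 ≤ |x| ∨ 1 ≤ y) →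
      ‖A (x + y * Complex.I)‖ + ‖b (x + y * Complex.I)‖ ≤ C) ∧
    (∀ x x' y : ℝ, 1 ≤ y →
      ‖A (x + y * Complex.I) - A (x' + y * Complex.I)‖ ≤ C / y ^ 2 * |x - x'|) ∧
    (∀ x x' y : ℝ, 1 ≤ y →
      ‖b (x + y * Complex.I)‖ - ‖b (x' + y * Complex.I)‖ ≤ C / y ^ 2 * |x - x'|) ∧
    (∀ x y : ℝ, 0 ≤ y → 1 ≤ |x| → ‖A (x + y * Complex.I) - A x‖ ≤ C / x ^ 2 * y) ∧
    (∀ x y : ℝ, 0 ≤ y → 1 ≤ |x| →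
      ‖b (x + y * Complex.I) - Real.exp (-2 * y) * b x‖ ≤ C / x ^ 2 * y) := by
  obtain ⟨M, hM, hbd⟩ := h.exists_bound
  have hw : ∀ x y r : ℝ, 0 ≤ y → (1 ≤ |x| ∨ 1 ≤ y) → 0 < r → r ≤ x ^ 2 + y ^ 2 → ∀ c : ℂ, ‖c‖ = 1 →
      ‖c * (Complex.I * q / (2 * (x + y * Complex.I) ^ 2) *
        (A (x + y * Complex.I) + b (x + y * Complex.I)))‖ ≤ ((‖q‖ + 1) * M) / r := by
    intro x y r hy hxy hr hrxy c hc
    refine (norm_coeff_le hc hr (by rwa [norm_sq_add_mul_I])).trans ?_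
    calc ‖q‖ / 2 / r * ‖A (x + y * Complex.I) + b (x + y * Complex.I)‖ ≤ (‖q‖ + 1) / r * M := by
          gcongr
          · linarith [norm_nonneg q]
          · exact (norm_add_le _ _).trans (hbd x y hy hxy)
      _ = _ := by ring
  have hCM : M ≤ (‖q‖ + 1) * M := le_mul_of_one_le_left hM.le (by linarith [norm_nonneg q])
  refine ⟨(‖q‖ + 1) * M, by positivity, fun x y hy hxy => (hbd x y hy hxy).trans hCM,
    fun x x' y hy => ?_, fun x x' y hy => ?_, fun x y hy hx => ?_, fun x y hy hx => ?_⟩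
  · have hy0 : 0 < y := by linarith
    have hne : ∀ t : ℝ, (t + y * Complex.I : ℂ) ≠ 0 := fun t => add_mul_I_ne_zero (by positivity)
    refine convex_univ.norm_image_sub_le_of_norm_hasDerivWithin_le (𝕜 := ℝ)
      (f := fun t : ℝ => A (t + y * Complex.I)) (fun t _ => (hasDerivAt_horizontal y t
        (h.hasDerivAt_fst _ (by simpa using hy0.le) (hne t))).hasDerivWithinAt)
      (fun t _ => ?_) (Set.mem_univ x') (Set.mem_univ x)
    simpa using hw t y (y ^ 2) hy0.le (Or.inr hy) (by positivity) (by nlinarith) 1 (by simp)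
  · have hy0 : 0 < y := by linarith
    have hne : ∀ t : ℝ, (t + y * Complex.I : ℂ) ≠ 0 := fun t => add_mul_I_ne_zero (by positivity)
    have hn : ∀ t : ℝ, ‖Complex.exp (-2 * t * Complex.I)‖ = 1 := fun t => by
      simpa using Complex.norm_exp_ofReal_mul_I (-2 * t)
    -- The unimodular factor `e^{-2it}` cancels the rotation `2ib`, leaving only the small coupling
    -- term.
    have hd : ∀ t : ℝ, HasDerivAt
        (fun t : ℝ => Complex.exp (-2 * t * Complex.I) * b (t + y * Complex.I))
        (-Complex.exp (-2 * t * Complex.I) * (Complex.I * q / (2 * (t + y * Complex.I) ^ 2) *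
        (A (t + y * Complex.I) + b (t + y * Complex.I)))) t := by
      intro t
      have h1 : HasDerivAt (fun t : ℝ => (-2 * t * Complex.I : ℂ)) (-2 * 1 * Complex.I) t :=
        ((Complex.ofRealCLM.hasDerivAt (x := t)).const_mul _).mul_const _
      refine (h1.cexp.mul (hasDerivAt_horizontal y t
        (h.hasDerivAt_snd _ (by simpa using hy0.le) (hne t)))).congr_deriv ?_
      ring
    have := convex_univ.norm_image_sub_le_of_norm_hasDerivWithin_le (𝕜 := ℝ)
      (fun t _ => (hd t).hasDerivWithinAt) (fun t _ =>
        hw t y (y ^ 2) hy0.le (Or.inr hy) (by positivity) (by nlinarith) _ ((norm_neg _).trans (hn t)))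
        (Set.mem_univ x') (Set.mem_univ x)
    refine le_trans ?_ this
    refine le_trans ?_ (norm_sub_norm_le _ _)
    simp only [norm_mul, hn, one_mul, le_refl]
  · have hx0 : 0 < x ^ 2 := by rw [← sq_abs]; positivity
    have hne : ∀ t : ℝ, (x + t * Complex.I : ℂ) ≠ 0 := fun t => add_mul_I_ne_zero (by positivity)
    have := (convex_Icc 0 y).norm_image_sub_le_of_norm_hasDerivWithin_le (𝕜 := ℝ)
      (f := fun t : ℝ => A (x + t * Complex.I)) (fun t ht => (hasDerivAt_vertical x t
        (h.hasDerivAt_fst _ (by simpa using ht.1) (hne t))).hasDerivWithinAt)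
      (fun t ht => hw x t (x ^ 2) ht.1 (Or.inl hx) hx0 (by nlinarith) _ (by simp))
      (Set.left_mem_Icc.2 hy) (Set.right_mem_Icc.2 hy)
    simpa [abs_of_nonneg hy] using this
  · have hx0 : 0 < x ^ 2 := by rw [← sq_abs]; positivity
    have hne : ∀ t : ℝ, (x + t * Complex.I : ℂ) ≠ 0 := fun t => add_mul_I_ne_zero (by positivity)
    -- The factor `e^{2t-2y}` cancels the damping and is at most 1 up to height `y`.
    have hd : ∀ t ∈ Set.Icc 0 y, HasDerivAt
        (fun t : ℝ => (Real.exp (2 * t - 2 * y) : ℂ) * b (x + t * Complex.I))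
        (Real.exp (2 * t - 2 * y) * (-Complex.I * (Complex.I * q / (2 * (x + t * Complex.I) ^ 2) *
        (A (x + t * Complex.I) + b (x + t * Complex.I))))) t := by
      intro t ht
      have h1 : HasDerivAt (fun t : ℝ => 2 * t - 2 * y) (2 * 1) t :=
        ((hasDerivAt_id t).const_mul 2).sub_const _
      refine (h1.exp.ofReal_comp.mul (hasDerivAt_vertical x t
        (h.hasDerivAt_snd _ (by simpa using ht.1) (hne t)))).congr_deriv ?_
      push_cast
      linear_combination 2 * Complex.exp (2 * t - 2 * y) * b (x + t * Complex.I) * Complex.I_mul_I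
    have := (convex_Icc 0 y).norm_image_sub_le_of_norm_hasDerivWithin_le (𝕜 := ℝ)
      (fun t ht => (hd t ht).hasDerivWithinAt) (C := ((‖q‖ + 1) * M) / x ^ 2) (fun t ht => by
        rw [norm_mul, Complex.norm_real, Real.norm_of_nonneg (Real.exp_pos _).le]
        refine (mul_le_of_le_one_left (norm_nonneg _) ?_).trans
          (hw x t (x ^ 2) ht.1 (Or.inl hx) hx0 (by nlinarith) _ (by simp))
        rw [Real.exp_le_one_iff]; linarith [ht.2])
      (Set.left_mem_Icc.2 hy) (Set.right_mem_Icc.2 hy)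
    simpa [abs_of_nonneg hy] using this

/-- The first amplitude has the same limit behaviour at both ends of the real line. -/
theorem exists_norm_neg_sub_le (h : AmplitudePair q ℓ A b) : ∃ C : ℝ, 0 < C ∧
    ∀ x : ℝ, 1 ≤ x → ‖A (-x) - A x‖ ≤ C / x := by
  obtain ⟨C, hC, -, hh, -, hv, -⟩ := h.exists_variation_bound
  refine ⟨4 * C, by positivity, fun x hx => ?_⟩
  have hx0 : 0 < x := by linarith
  have h1 := hv x x hx0.le (by rwa [abs_of_pos hx0])
  have h2 := hv (-x) x hx0.le (by rwa [abs_neg, abs_of_pos hx0])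
  have h3 := hh (-x) x x hx
  have e1 : C / x ^ 2 * x = C / x := by field_simp
  have e2 : C / x ^ 2 * |-x - x| = 2 * (C / x) := by
    rw [show -x - x = -(2 * x) by ring, abs_neg, abs_of_pos (by positivity)]; field_simp
  rw [neg_sq, e1] at h2
  rw [e1] at h1
  rw [e2] at h3
  push_cast at h2 h3
  -- Path around the origin through the corners `-x + ix` and `x + ix`: length of order `x`,
  -- derivative of order `1/x²`.
  have e : A (-x) - A x = -(A (-x + x * Complex.I) - A (-x)) +
      (A (-x + x * Complex.I) - A (x + x * Complex.I)) + (A (x + x * Complex.I) - A x) := by ring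
  rw [e]
  refine (norm_add₃_le).trans ?_
  rw [norm_neg, mul_div_assoc]
  linarith

/-- The first amplitude of a nontrivial solution is bounded below on the real line. -/
theorem exists_lower_bound (h : AmplitudePair q ℓ A b) {x₀ : ℝ} (hx₀ : 1 ≤ x₀)
    (hne : A x₀ + b x₀ ≠ 0) : ∃ δ X : ℝ, 0 < δ ∧ 1 ≤ X ∧ ∀ x : ℝ, X ≤ |x| → δ ≤ ‖A x‖ := by
  obtain ⟨C, hC, hneg⟩ := h.exists_norm_neg_sub_le
  have hℓ := h.factor_pos
  set E := Real.exp (4 * ‖q‖ * Real.pi) with hE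
  have hE0 : 0 < E := Real.exp_pos _
  have hN : 0 < ‖A x₀‖ ^ 2 + ‖b x₀‖ ^ 2 := by
    by_contra hcon
    have h1 : ‖A x₀‖ ^ 2 = 0 := le_antisymm (by nlinarith [sq_nonneg ‖b x₀‖]) (sq_nonneg _)
    have h2 : ‖b x₀‖ ^ 2 = 0 := le_antisymm (by nlinarith [sq_nonneg ‖A x₀‖]) (sq_nonneg _)
    simp only [ne_eq, OfNat.ofNat_ne_zero, not_false_eq_true, pow_eq_zero_iff, norm_eq_zero] at h1 h2
    exact hne (by rw [h1, h2, add_zero])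
  set η := Real.sqrt ((‖A x₀‖ ^ 2 + ‖b x₀‖ ^ 2) / E) with hη
  have hη0 : 0 < η := Real.sqrt_pos.2 (by positivity)
  have hlow : ∀ x : ℝ, x₀ ≤ x → η ≤ ‖A x‖ + ‖b x‖ := by
    intro x hx
    have h1 := h.normSq_left_le (y := 0) le_rfl hx (Or.inl hx₀)
    simp only [Complex.ofReal_zero, zero_mul, add_zero] at h1
    rw [hη]
    refine Real.sqrt_le_iff.2 ⟨by positivity, ?_⟩
    rw [div_le_iff₀ hE0]
    refine h1.trans ?_
    rw [mul_comm]
    refine mul_le_mul_of_nonneg_right ?_ hE0.le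
    nlinarith [mul_nonneg (norm_nonneg (A x)) (norm_nonneg (b x))]
  -- `A` and `b` cannot both be small, and `ℓ|b(x)| = |A(-x)|` is within `C/x` of `|A(x)|`; so `A`
  -- alone is bounded below.
  have hpos : ∀ x : ℝ, max x₀ (2 * C / (ℓ * η)) ≤ x → η / (2 * (1 + 1 / ℓ)) ≤ ‖A x‖ := by
    intro x hx
    have hx1 := (le_max_left _ _).trans hx
    have hx2 := (le_max_right _ _).trans hx
    have hx0 : 0 < x := by linarith
    have h1 := hlow x hx1
    have h2 := h.norm_fst_neg x hx0
    have h3 := (norm_sub_norm_le _ _).trans (hneg x (hx₀.trans hx1))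
    rw [h2] at h3
    rw [div_le_iff₀ (by positivity)] at hx2 ⊢
    have h4 : C / x ≤ ℓ * η / 2 := by
      rw [div_le_iff₀ hx0]; linarith
    have h5 : ‖b x‖ ≤ ‖A x‖ / ℓ + η / 2 := by
      rw [← mul_le_mul_iff_right₀ hℓ, mul_add, mul_div_cancel₀ _ hℓ.ne']; linarith
    have e : ‖A x‖ * (2 * (1 + 1 / ℓ)) = 2 * (‖A x‖ + ‖A x‖ / ℓ) := by ring
    rw [e]; linarith
  set δ := η / (2 * (1 + 1 / ℓ)) with hδ
  have hδ0 : 0 < δ := by positivity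
  refine ⟨δ / 2, max (max x₀ (2 * C / (ℓ * η))) (2 * C / δ), by positivity,
    hx₀.trans ((le_max_left _ _).trans (le_max_left _ _)), fun x hx => ?_⟩
  have hx1 := (le_max_left _ _).trans hx
  have hx2 := (le_max_right _ _).trans hx
  have hx3 : 1 ≤ |x| := hx₀.trans ((le_max_left _ _).trans hx1)
  have h1 := hpos _ hx1
  rcases abs_cases x with ⟨h2, -⟩ | ⟨h2, -⟩
  · rw [h2] at h1; linarith
  · have h3 := hneg _ hx3
    rw [div_le_iff₀ hδ0] at hx2
    have h4 : C / |x| ≤ δ / 2 := by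
      rw [div_le_iff₀ (by linarith)]; linarith
    rw [h2] at h1 h3 h4
    rw [Complex.ofReal_neg, neg_neg] at h3
    rw [Complex.ofReal_neg] at h1
    have h5 := norm_sub_norm_le (A (-x)) (A x)
    rw [norm_sub_rev] at h3
    linarith

theorem exists_abs_lt_of_abs_one_sub_exp_le {ε : ℝ} (hε : 0 < ε) :
    ∃ η : ℝ, 0 < η ∧ ∀ t : ℝ, |1 - Real.exp t| ≤ η → |t| < ε := by
  have h := (Real.continuousAt_log one_ne_zero)
  rw [Metric.continuousAt_iff] at h
  obtain ⟨η, hη, h⟩ := h ε hε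
  refine ⟨η / 2, by positivity, fun t ht => ?_⟩
  have := h (x := Real.exp t) (by rw [Real.dist_eq, abs_sub_comm]; linarith)
  simpa [Real.dist_eq] using this

/-- Large zeros of a nontrivial solution in the upper half plane approach the line
`2 Im z = |log ℓ|`. -/
theorem exists_abs_two_mul_sub_abs_log_lt (h : AmplitudePair q ℓ A b) {x₀ : ℝ} (hx₀ : 1 ≤ x₀)
    (hne : A x₀ + b x₀ ≠ 0) {ε : ℝ} (hε : 0 < ε) : ∃ R : ℝ, ∀ x y : ℝ, 0 ≤ y → R ≤ max |x| y →
      A (x + y * Complex.I) + b (x + y * Complex.I) = 0 → |2 * y - (|Real.log ℓ|)| < ε := by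
  obtain ⟨C, hC, hbd, hhA, hhb, hvA, hvb⟩ := h.exists_variation_bound
  obtain ⟨D, hD, hneg⟩ := h.exists_norm_neg_sub_le
  obtain ⟨δ, X, hδ, hX, hlow⟩ := h.exists_lower_bound hx₀ hne
  obtain ⟨η, hη, hexp⟩ := exists_abs_lt_of_abs_one_sub_exp_le hε
  have hℓ := h.factor_pos
  set K := 2 * C + D * (ℓ + 1 / ℓ) with hK
  have hK0 : 0 < K := by positivity
  refine ⟨max (max X (K / (δ * η))) (7 * C / δ + C / δ), fun x y hy hR hzero => ?_⟩
  set r := max |x| y with hr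
  have hRX : X ≤ r := (le_max_left _ _).trans ((le_max_left _ _).trans hR)
  have hRK : K / (δ * η) ≤ r := (le_max_right _ _).trans ((le_max_left _ _).trans hR)
  have hRC : 7 * C / δ + C / δ ≤ r := (le_max_right _ _).trans hR
  have hr1 : 1 ≤ r := hX.trans hRX
  have hr0 : 0 < r := by linarith
  have hAb : ‖A (x + y * Complex.I)‖ = ‖b (x + y * Complex.I)‖ := by
    rw [eq_neg_of_add_eq_zero_left hzero, norm_neg]
  rcases le_total |x| y with hxy | hxy
  -- No large zero has `y ≥ |x|`: there `b` is `O(1/y)` while `A` stays near a value of modulus at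
  -- least `δ`. Seven errors `C/y` accumulate; the extra `C/δ` in the radius makes the contradiction
  -- strict.
  · exfalso
    have hry : r = y := max_eq_right hxy
    rw [hry] at hRX hRK hRC hr1 hr0
    have h1 := (norm_sub_norm_le _ _).trans (hvA y y hy (by rwa [abs_of_nonneg hy]))
    have h1' := (norm_sub_norm_le _ _).trans ((norm_sub_rev _ _).le.trans
      (hvA y y hy (by rwa [abs_of_nonneg hy])))
    have h2 := (norm_sub_norm_le _ _).trans (hvb y y hy (by rwa [abs_of_nonneg hy]))
    have h3 := (norm_sub_norm_le _ _).trans (hhA y x y hr1)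
    have h4 := hhb x y y hr1
    have h5 := hlow y (by rwa [abs_of_nonneg hy])
    have h6 : |x - y| ≤ 2 * y := by
      rw [abs_le] at *; constructor <;> linarith [hxy.1, hxy.2]
    have e1 : C / y ^ 2 * y = C / y := by field_simp
    have e2 : C / y ^ 2 * |x - y| ≤ 2 * (C / y) := by
      calc C / y ^ 2 * |x - y| ≤ C / y ^ 2 * (2 * y) := by gcongr
        _ = _ := by field_simp
    have h7 : ‖b y‖ ≤ C := by
      have := hbd y 0 le_rfl (Or.inl (by rwa [abs_of_nonneg hy]))
      simp only [Complex.ofReal_zero, zero_mul, add_zero] at this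
      linarith [norm_nonneg (A y)]
    have h8 : Real.exp (-2 * y) ≤ 1 / y := by
      rw [show -2 * y = -(2 * y) by ring, Real.exp_neg, ← one_div]
      apply one_div_le_one_div_of_le hr0
      linarith [Real.add_one_le_exp (2 * y)]
    have h9 : ‖(Real.exp (-2 * y) : ℂ) * b y‖ ≤ C / y := by
      rw [norm_mul, Complex.norm_real, Real.norm_of_nonneg (Real.exp_pos _).le]
      calc _ ≤ 1 / y * C := by gcongr
        _ = _ := by ring
    rw [abs_sub_comm] at h3
    rw [e1] at h1 h1' h2
    have h10 : δ ≤ 7 * (C / y) := by linarith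
    have h11 : 7 * (C / y) < δ := by
      rw [← mul_div_assoc, div_lt_iff₀ hr0, ← div_lt_iff₀' hδ]
      have : 0 < C / δ := by positivity
      linarith
    linarith
  · have hrx : r = |x| := max_eq_left hxy
    rw [hrx] at hRX hRK hRC hr1 hr0
    have e1 : C / x ^ 2 * y ≤ C / |x| := by
      rw [← sq_abs x]
      calc C / |x| ^ 2 * y ≤ C / |x| ^ 2 * |x| := by gcongr
        _ = _ := by field_simp
    have h1 := (abs_norm_sub_norm_le _ _).trans ((hvA x y hy hr1).trans e1)
    have h2 := (abs_norm_sub_norm_le _ _).trans ((hvb x y hy hr1).trans e1)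
    have h3 := hlow x hRX
    rw [norm_mul, Complex.norm_real, Real.norm_of_nonneg (Real.exp_pos _).le] at h2
    -- Here `m` is the limiting ratio `|b|/|A|` on the half line containing `x`: `1/ℓ` on the right,
    -- `ℓ` on the left. The equality `|A| = |b|` at a zero then gives `e^{-2y} m ≈ 1`.
    have key : ∀ m : ℝ, 0 < m → m ≤ ℓ + 1 / ℓ → |Real.log m| = |Real.log ℓ| →
        |‖b x‖ - m * ‖A x‖| ≤ m * (D / |x|) → |2 * y - (|Real.log ℓ|)| < ε := by
      intro m hm hmℓ hml h4
      have h5 : |(1 - Real.exp (-2 * y + Real.log m)) * ‖A x‖| ≤ K / |x| := by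
        have e : (1 - Real.exp (-2 * y + Real.log m)) * ‖A x‖ =
            -(‖A (x + y * Complex.I)‖ - ‖A x‖) +
            (‖b (x + y * Complex.I)‖ - Real.exp (-2 * y) * ‖b x‖) +
            Real.exp (-2 * y) * (‖b x‖ - m * ‖A x‖) := by
          rw [Real.exp_add, Real.exp_log hm, hAb]; ring
        rw [e]
        refine (abs_add_three _ _ _).trans ?_
        rw [abs_neg, abs_mul, abs_of_pos (Real.exp_pos _)]
        have h6 : Real.exp (-2 * y) * |‖b x‖ - m * ‖A x‖| ≤ (ℓ + 1 / ℓ) * (D / |x|) := by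
          calc _ ≤ 1 * (m * (D / |x|)) := by
                gcongr
                rw [Real.exp_le_one_iff]; linarith
            _ ≤ _ := by rw [one_mul]; gcongr
        have e3 : K / |x| = C / |x| + C / |x| + (ℓ + 1 / ℓ) * (D / |x|) := by rw [hK]; ring
        rw [e3]; linarith
      have h7 : |1 - Real.exp (-2 * y + Real.log m)| ≤ η := by
        rw [abs_mul, abs_of_nonneg (norm_nonneg _)] at h5
        have h8 : K / |x| ≤ η * δ := by
          rw [div_le_iff₀ (by positivity)] at hRK ⊢
          linarith
        have h9 := mul_le_mul_of_nonneg_left h3 (abs_nonneg (1 - Real.exp (-2 * y + Real.log m)))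
        exact le_of_mul_le_mul_right (h9.trans (h5.trans h8)) hδ
      have h8 := hexp _ h7
      have h9 := abs_abs_sub_abs_le (2 * y) (Real.log m)
      rw [abs_of_nonneg (by positivity : (0 : ℝ) ≤ 2 * y), hml] at h9
      refine h9.trans_lt ?_
      rwa [abs_sub_comm, show Real.log m - 2 * y = -2 * y + Real.log m by ring]
    rcases abs_cases x with ⟨h4, -⟩ | ⟨h4, -⟩
    · rw [h4] at hr0 hr1
      refine key (1 / ℓ) (by positivity) (by linarith) (by simp) ?_
      have h5 := h.norm_fst_neg x hr0
      have h6 := (abs_norm_sub_norm_le _ _).trans (hneg x hr1)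
      rw [h4]
      have e : ‖b x‖ - 1 / ℓ * ‖A x‖ = 1 / ℓ * (‖A (-x)‖ - ‖A x‖) := by
        rw [h5]; field_simp
      rw [e, abs_mul, abs_of_pos (by positivity)]
      gcongr
    · rw [h4] at hr0 hr1
      refine key ℓ hℓ (by linarith [one_div_pos.2 hℓ]) rfl ?_
      have h5 := h.norm_snd_neg (-x) hr0
      have h6 := (abs_norm_sub_norm_le _ _).trans (hneg (-x) hr1)
      rw [h4]
      rw [Complex.ofReal_neg, neg_neg] at h5 h6
      rw [abs_sub_comm] at h6
      rw [h5, ← mul_sub, abs_mul, abs_of_pos hℓ]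
      gcongr

end AmplitudePair

/-! ### Identities for the normalized Bessel function -/

theorem one_div_Gamma_eq (s : ℂ) : (Complex.Gamma s)⁻¹ = s * (Complex.Gamma (s + 1))⁻¹ :=
  Complex.one_div_Gamma_eq_self_mul_one_div_Gamma_add_one s

theorem normalizedBessel_neg (ν z : ℂ) : normalizedBessel ν (-z) = normalizedBessel ν z := by
  unfold normalizedBessel
  refine tsum_congr fun k => ?_
  rw [neg_div, (even_two_mul k).neg_pow]

theorem normalizedBessel_zero (ν : ℂ) : normalizedBessel ν 0 = (Complex.Gamma (ν + 1))⁻¹ := by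
  unfold normalizedBessel
  rw [tsum_eq_single 0 (fun k hk => by simp [hk])]
  simp

theorem normalizedBessel_zero_ne_zero {ν : ℂ} (hν : ν.im ≠ 0) : normalizedBessel ν 0 ≠ 0 := by
  rw [normalizedBessel_zero]
  refine inv_ne_zero (Complex.Gamma_ne_zero fun m hm => hν ?_)
  simpa using congrArg Complex.im hm

theorem hasDerivAt_normalizedBessel (ν z : ℂ) :
    HasDerivAt (normalizedBessel ν) (-(z / 2) * normalizedBessel (ν + 1) z) z := by
  set c : ℕ → ℂ := fun k => (-1 : ℂ) ^ k /
    ((Nat.factorial k : ℂ) * Complex.Gamma ((k : ℂ) + ν + 1)) with hc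
  set R : ℝ := ‖z‖ + 1 with hR
  have hR0 : 0 ≤ R := by positivity
  have hz : z ∈ Metric.ball (0 : ℂ) R := by simp [hR]
  have hFd : ∀ (k : ℕ) (w : ℂ), HasDerivAt (fun w => c k * (w / 2) ^ (2 * k))
      (c k * (((2 * k : ℕ) : ℂ) * (w / 2) ^ (2 * k - 1) * (1 / 2))) w := fun k w =>
    (((hasDerivAt_id w).div_const 2).pow (2 * k)).const_mul (c k)
  have hu : Summable fun k : ℕ => ‖c k * ((R : ℂ) / 2) ^ (2 * k)‖ :=
    (normalizedBessel_summable ν R).norm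
  have hle : ∀ (k : ℕ) (w : ℂ), w ∈ Metric.ball (0 : ℂ) R →
      ‖c k * (w / 2) ^ (2 * k)‖ ≤ ‖c k * ((R : ℂ) / 2) ^ (2 * k)‖ := by
    intro k w hw
    have h1 : ‖w‖ ≤ R := by simpa using (Metric.mem_ball.1 hw).le
    have h2 : ‖w / 2‖ ≤ ‖(R : ℂ) / 2‖ := by
      rw [norm_div, norm_div, Complex.norm_real, Real.norm_of_nonneg hR0]
      gcongr
    rw [norm_mul, norm_mul, norm_pow, norm_pow]
    gcongr
  have hdiff : ∀ k : ℕ, DifferentiableOn ℂ (fun w => c k * (w / 2) ^ (2 * k)) (Metric.ball 0 R) :=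
    fun k w _ => (hFd k w).differentiableAt.differentiableWithinAt
  have h1 := Complex.hasSum_deriv_of_summable_norm hu hdiff Metric.isOpen_ball hle hz
  have h2 : DifferentiableAt ℂ (normalizedBessel ν) z :=
    (Complex.differentiableOn_tsum_of_summable_norm hu hdiff Metric.isOpen_ball hle).differentiableAt
      (Metric.isOpen_ball.mem_nhds hz)
  have h4 : (fun k => deriv (fun w => c k * (w / 2) ^ (2 * k)) z) =
      fun k => c k * (((2 * k : ℕ) : ℂ) * (z / 2) ^ (2 * k - 1) * (1 / 2)) :=
    funext fun k => (hFd k z).deriv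
  rw [h4] at h1
  have h5 : deriv (normalizedBessel ν) z = -(z / 2) * normalizedBessel (ν + 1) z := by
    refine h1.unique ?_
    rw [← hasSum_nat_add_iff' 1]
    simp only [Finset.range_one, Finset.sum_singleton, mul_zero, CharP.cast_eq_zero, zero_mul,
      sub_zero]
    refine ((normalizedBessel_summable (ν + 1) z).hasSum.mul_left (-(z / 2))).congr_fun ?_
    intro k
    have e1 : ((k + 1 : ℕ) : ℂ) + ν + 1 = (k : ℂ) + (ν + 1) + 1 := by push_cast; ring
    have e2 : 2 * (k + 1) - 1 = 2 * k + 1 := by omega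
    have e3 : (k : ℂ) + 1 ≠ 0 := Nat.cast_add_one_ne_zero k
    simp only [hc]
    rw [e1, e2, Nat.factorial_succ]
    push_cast
    simp only [div_eq_mul_inv, mul_inv]
    field_simp
    ring
  rw [← h5]
  exact h2.hasDerivAt

/-- Coefficient comparison using `1/Γ(s) = s/Γ(s+1)`, which also holds at the poles of `Γ`, so `ν`
is arbitrary. -/
theorem normalizedBessel_recurrence (ν z : ℂ) : normalizedBessel ν z =
    (ν + 1) * normalizedBessel (ν + 1) z - z ^ 2 / 4 * normalizedBessel (ν + 1 + 1) z := by
  have h1 := (normalizedBessel_summable ν z).hasSum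
  have h2 := ((normalizedBessel_summable (ν + 1) z).hasSum.mul_left (ν + 1))
  have h3 := ((normalizedBessel_summable (ν + 1 + 1) z).hasSum.mul_left (z ^ 2 / 4))
  have h4 := h1.sub h2
  rw [← hasSum_nat_add_iff' 1] at h4
  have e0 := one_div_Gamma_eq (ν + 1)
  have h5 := h4.unique (h3.neg.congr_fun fun k => ?_)
  · simp only [Finset.range_one, Finset.sum_singleton] at h5
    simp only [pow_zero, Nat.factorial_zero, Nat.cast_one, Nat.cast_zero, one_mul, zero_add,
      mul_zero, mul_one, one_div, e0, sub_self, sub_zero] at h5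
    unfold normalizedBessel
    linear_combination h5
  · have e1 : ((k + 1 : ℕ) : ℂ) + ν + 1 = (k : ℂ) + ν + 2 := by push_cast; ring
    have e2 : ((k + 1 : ℕ) : ℂ) + (ν + 1) + 1 = (k : ℂ) + ν + 2 + 1 := by push_cast; ring
    have e3 : (k : ℂ) + (ν + 1 + 1) + 1 = (k : ℂ) + ν + 2 + 1 := by ring
    have e4 : (k : ℂ) + 1 ≠ 0 := Nat.cast_add_one_ne_zero k
    rw [e1, e2, e3, Nat.factorial_succ]
    push_cast
    simp only [div_eq_mul_inv, mul_inv]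
    rw [one_div_Gamma_eq ((k : ℂ) + ν + 2)]
    field_simp
    ring

/-! ### Bessel's equation in normal form and its amplitudes -/

/-- The branch of `z ^ s` on the punctured closed upper half plane that is obtained by cutting the
plane along the negative imaginary axis, up to a constant factor. -/
noncomputable def upperPow (s z : ℂ) : ℂ := Complex.exp (s * Complex.log (-Complex.I * z))

theorem neg_I_mul_mem_slitPlane {z : ℂ} (hz : 0 ≤ z.im) (hz0 : z ≠ 0) :
    -Complex.I * z ∈ Complex.slitPlane := by
  rw [Complex.mem_slitPlane_iff]
  by_contra! h
  simp only [neg_mul, Complex.neg_re, Complex.mul_re, Complex.I_re, zero_mul, Complex.I_im,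
    one_mul, zero_sub, neg_neg, Complex.neg_im, Complex.mul_im, zero_add, neg_eq_zero] at h
  exact hz0 (Complex.ext h.2 (le_antisymm h.1 hz))

theorem hasDerivAt_upperPow (s : ℂ) {z : ℂ} (hz : 0 ≤ z.im) (hz0 : z ≠ 0) :
    HasDerivAt (upperPow s) (upperPow s z * (s / z)) z := by
  have h1 : HasDerivAt (fun z : ℂ => -Complex.I * z) (-Complex.I * 1) z :=
    (hasDerivAt_id z).const_mul _
  refine (((h1.clog (neg_I_mul_mem_slitPlane hz hz0)).const_mul s).cexp).congr_deriv ?_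
  have h2 : -Complex.I * 1 / (-Complex.I * z) = 1 / z :=
    mul_div_mul_left _ _ (neg_ne_zero.2 Complex.I_ne_zero)
  rw [h2, mul_one_div]
  rfl

theorem upperPow_neg (s : ℂ) {x : ℝ} (hx : 0 < x) :
    upperPow s (-x) = Complex.exp (Real.pi * Complex.I * s) * upperPow s x := by
  unfold upperPow
  rw [← Complex.exp_add, show -Complex.I * -(x : ℂ) = x * Complex.I by ring,
    show -Complex.I * (x : ℂ) = x * -Complex.I by ring,
    Complex.log_ofReal_mul hx Complex.I_ne_zero,
    Complex.log_ofReal_mul hx (neg_ne_zero.2 Complex.I_ne_zero), Complex.log_I, Complex.log_neg_I]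
  ring_nf

/-- The solution `z ^ (ν + 1/2) j_ν(z)` of Bessel's equation in normal form. -/
noncomputable def besselNormal (ν z : ℂ) : ℂ := upperPow (ν + 1 / 2) z * normalizedBessel ν z

/-- The derivative of `besselNormal`. -/
noncomputable def besselNormalDeriv (ν z : ℂ) : ℂ := upperPow (ν + 1 / 2) z *
  ((ν + 1 / 2) / z * normalizedBessel ν z - z / 2 * normalizedBessel (ν + 1) z)

theorem hasDerivAt_besselNormal (ν : ℂ) {z : ℂ} (hz : 0 ≤ z.im) (hz0 : z ≠ 0) :
    HasDerivAt (besselNormal ν) (besselNormalDeriv ν z) z := by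
  refine ((hasDerivAt_upperPow (ν + 1 / 2) hz hz0).mul
    (hasDerivAt_normalizedBessel ν z)).congr_deriv ?_
  unfold besselNormalDeriv
  ring

theorem hasDerivAt_besselNormalDeriv (ν : ℂ) {z : ℂ} (hz : 0 ≤ z.im) (hz0 : z ≠ 0) :
    HasDerivAt (besselNormalDeriv ν) (((ν ^ 2 - 1 / 4) / z ^ 2 - 1) * besselNormal ν z) z := by
  have h1 : HasDerivAt (fun z : ℂ => (ν + 1 / 2) / z) (-((ν + 1 / 2) / z ^ 2)) z := by
    refine ((hasDerivAt_inv hz0).const_mul (ν + 1 / 2)).congr_deriv ?_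
    ring
  have h2 : HasDerivAt (fun z : ℂ => z / 2) (1 / 2) z := (hasDerivAt_id z).div_const 2
  refine ((hasDerivAt_upperPow (ν + 1 / 2) hz hz0).mul
    ((h1.mul (hasDerivAt_normalizedBessel ν z)).sub
      (h2.mul (hasDerivAt_normalizedBessel (ν + 1) z)))).congr_deriv ?_
  have h3 := normalizedBessel_recurrence ν z
  unfold besselNormal
  simp only [Pi.sub_apply, Pi.mul_apply]
  field_simp
  linear_combination (16 * z ^ 2) * upperPow ((ν * 2 + 1) / 2) z * h3

theorem besselNormal_neg (ν : ℂ) {x : ℝ} (hx : 0 < x) : besselNormal ν (-x) =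
    Complex.exp (Real.pi * Complex.I * (ν + 1 / 2)) * besselNormal ν x := by
  unfold besselNormal
  rw [upperPow_neg _ hx, normalizedBessel_neg, mul_assoc]

theorem besselNormalDeriv_neg (ν : ℂ) {x : ℝ} (hx : 0 < x) : besselNormalDeriv ν (-x) =
    -(Complex.exp (Real.pi * Complex.I * (ν + 1 / 2)) * besselNormalDeriv ν x) := by
  unfold besselNormalDeriv
  rw [upperPow_neg _ hx, normalizedBessel_neg, normalizedBessel_neg, div_neg]
  ring

/-- The amplitude `e^{iz} (u + c u') / 2` of `u = z ^ (ν + 1/2) j_ν(z)`. -/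
noncomputable def besselAmplitude (ν c z : ℂ) : ℂ :=
  Complex.exp (Complex.I * z) * (besselNormal ν z + c * besselNormalDeriv ν z) / 2

theorem besselAmplitude_add (ν z : ℂ) :
    besselAmplitude ν Complex.I z + besselAmplitude ν (-Complex.I) z =
      Complex.exp (Complex.I * z) * besselNormal ν z := by
  unfold besselAmplitude
  ring

theorem hasDerivAt_besselAmplitude (ν c : ℂ) {z : ℂ} (hz : 0 ≤ z.im) (hz0 : z ≠ 0) :
    HasDerivAt (besselAmplitude ν c) (Complex.exp (Complex.I * z) *
      (Complex.I * (besselNormal ν z + c * besselNormalDeriv ν z) + besselNormalDeriv ν z +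
        c * (((ν ^ 2 - 1 / 4) / z ^ 2 - 1) * besselNormal ν z)) / 2) z := by
  have h1 : HasDerivAt (fun z : ℂ => Complex.I * z) (Complex.I * 1) z :=
    (hasDerivAt_id z).const_mul _
  refine ((h1.cexp.mul ((hasDerivAt_besselNormal ν hz hz0).add
    ((hasDerivAt_besselNormalDeriv ν hz hz0).const_mul c))).div_const 2).congr_deriv ?_
  simp only [Pi.add_apply]
  ring

/-- Under `x ↦ -x` both `u` and `u'` gain the factor `e^{iπ(ν+1/2)}`, but `u'` also changes sign,
which swaps `c` and `-c`. -/
theorem norm_besselAmplitude_neg (ν c : ℂ) {x : ℝ} (hx : 0 < x) :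
    ‖besselAmplitude ν c (-x)‖ =
      Real.exp (-(Real.pi * ν.im)) * ‖besselAmplitude ν (-c) x‖ := by
  have h1 : ∀ t : ℝ, ‖Complex.exp (Complex.I * t)‖ = 1 := fun t => by
    rw [mul_comm]; exact Complex.norm_exp_ofReal_mul_I t
  have h2 : ‖Complex.exp (Real.pi * Complex.I * (ν + 1 / 2))‖ = Real.exp (-(Real.pi * ν.im)) := by
    rw [Complex.norm_exp]
    congr 1
    simp [Complex.mul_re, Complex.mul_im]
  unfold besselAmplitude
  rw [besselNormal_neg ν hx, besselNormalDeriv_neg ν hx, norm_div, norm_div, norm_mul, norm_mul,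
    ← Complex.ofReal_neg, h1, h1, ← h2, ← mul_div_assoc, one_mul, one_mul, ← norm_mul]
  ring_nf

theorem amplitudePair_bessel (ν : ℂ) : AmplitudePair (ν ^ 2 - 1 / 4)
    (Real.exp (-(Real.pi * ν.im))) (besselAmplitude ν Complex.I)
    (besselAmplitude ν (-Complex.I)) where
  hasDerivAt_fst z hz hz0 := by
    refine (hasDerivAt_besselAmplitude ν _ hz hz0).congr_deriv ?_
    rw [besselAmplitude_add]
    linear_combination
      Complex.exp (Complex.I * z) * besselNormalDeriv ν z / 2 * Complex.I_mul_I
  hasDerivAt_snd z hz hz0 := by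
    refine (hasDerivAt_besselAmplitude ν _ hz hz0).congr_deriv ?_
    rw [besselAmplitude_add]
    unfold besselAmplitude
    linear_combination
      Complex.exp (Complex.I * z) * besselNormalDeriv ν z / 2 * Complex.I_mul_I
  factor_pos := Real.exp_pos _
  norm_fst_neg x hx := norm_besselAmplitude_neg ν _ hx
  norm_snd_neg x hx := by rw [norm_besselAmplitude_neg ν _ hx, neg_neg]

/-! ### Zeros of `j_ν` for nonreal order -/

theorem differentiable_normalizedBessel (ν : ℂ) : Differentiable ℂ (normalizedBessel ν) :=
  fun z => (hasDerivAt_normalizedBessel ν z).differentiableAt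

/-- The zeros of `j_ν` for nonreal `ν` have no accumulation point. -/
theorem eventually_normalizedBessel_ne_zero {ν : ℂ} (hν : ν.im ≠ 0) (w : ℂ) :
    ∀ᶠ z in nhdsWithin w {w}ᶜ, normalizedBessel ν z ≠ 0 := by
  have han : AnalyticOnNhd ℂ (normalizedBessel ν) Set.univ :=
    (differentiable_normalizedBessel ν).differentiableOn.analyticOnNhd isOpen_univ
  refine ((han w trivial).eventually_eq_zero_or_eventually_ne_zero).resolve_left fun h => ?_
  exact normalizedBessel_zero_ne_zero hν
    (han.eqOn_zero_of_preconnected_of_eventuallyEq_zero isPreconnected_univ trivial h trivial)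

theorem exists_one_le_normalizedBessel_ne_zero {ν : ℂ} (hν : ν.im ≠ 0) :
    ∃ x : ℝ, 1 ≤ x ∧ normalizedBessel ν x ≠ 0 := by
  have h1 : Filter.Tendsto (fun x : ℝ => (x : ℂ)) (nhdsWithin 1 (Set.Ioi 1))
      (nhdsWithin ((1 : ℝ) : ℂ) {((1 : ℝ) : ℂ)}ᶜ) := by
    refine tendsto_nhdsWithin_of_tendsto_nhds_of_eventually_within _
      (Complex.continuous_ofReal.continuousAt.tendsto.mono_left nhdsWithin_le_nhds) ?_
    filter_upwards [self_mem_nhdsWithin] with x hx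
    simpa using (ne_of_gt hx)
  obtain ⟨x, hx, hx1⟩ :=
    ((h1.eventually (eventually_normalizedBessel_ne_zero hν _)).and self_mem_nhdsWithin).exists
  exact ⟨x, (le_of_lt hx1), hx⟩

/-- The zeros of `j_ν` for nonreal `ν` approach the lines `|Im z| = π |Im ν| / 2`. -/
theorem exists_abs_two_mul_abs_im_sub_lt {ν : ℂ} (hν : ν.im ≠ 0) {ε : ℝ} (hε : 0 < ε) :
    ∃ R : ℝ, ∀ a : ℂ, IsBesselZero ν a → R ≤ ‖a‖ →
      |2 * |a.im| - Real.pi * (|ν.im|)| < ε := by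
  obtain ⟨x₀, hx₀, hne⟩ := exists_one_le_normalizedBessel_ne_zero hν
  have hne' : besselAmplitude ν Complex.I x₀ + besselAmplitude ν (-Complex.I) x₀ ≠ 0 := by
    rw [besselAmplitude_add]
    exact mul_ne_zero (Complex.exp_ne_zero _) (mul_ne_zero (Complex.exp_ne_zero _) hne)
  obtain ⟨R, hR⟩ := (amplitudePair_bessel ν).exists_abs_two_mul_sub_abs_log_lt hx₀ hne' hε
  rw [Real.log_exp, abs_neg, abs_mul, abs_of_pos Real.pi_pos] at hR
  have key : ∀ a : ℂ, 0 ≤ a.im → IsBesselZero ν a → 2 * R ≤ ‖a‖ →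
      |2 * |a.im| - Real.pi * (|ν.im|)| < ε := by
    intro a ha hzero hRa
    rw [abs_of_nonneg ha]
    refine hR a.re a.im ha ?_ ?_
    · have h1 := Complex.norm_le_abs_re_add_abs_im a
      rw [abs_of_nonneg ha] at h1
      linarith [le_max_left |a.re| a.im, le_max_right |a.re| a.im]
    · rw [Complex.re_add_im, besselAmplitude_add]
      unfold besselNormal
      rw [show normalizedBessel ν a = 0 from hzero, mul_zero, mul_zero]
  refine ⟨2 * R, fun a ha hRa => ?_⟩
  rcases le_total 0 a.im with h | h
  · exact key a h ha hRa
  · have := key (-a) (by simpa using h) ((normalizedBessel_neg ν a).trans ha) (by simpa using hRa)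
    simpa using this

/-- There are finitely many zeros of `j_ν` in every disc, if `ν` is not real. -/
theorem finite_setOf_isBesselZero_norm_le {ν : ℂ} (hν : ν.im ≠ 0) (R : ℝ) :
    {a : ℂ | IsBesselZero ν a ∧ ‖a‖ ≤ R}.Finite := by
  by_contra hinf
  obtain ⟨w, -, hw⟩ := Set.Infinite.exists_accPt_of_subset_isCompact hinf
    (isCompact_closedBall (0 : ℂ) R) (fun a ha => by simpa using ha.2)
  rw [accPt_iff_frequently_nhdsNE] at hw
  exact hw ((eventually_normalizedBessel_ne_zero hν w).mono fun z hz hz' => hz hz'.1)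

theorem IsBesselZero.neg {ν a : ℂ} (h : IsBesselZero ν a) : IsBesselZero ν (-a) :=
  (normalizedBessel_neg ν a).trans h

theorem IsBesselZero.ne_zero {ν a : ℂ} (hν : ν.im ≠ 0) (h : IsBesselZero ν a) : a ≠ 0 := by
  rintro rfl
  exact normalizedBessel_zero_ne_zero hν h

theorem IsBesselZero.isBesselRational_div {ν a b : ℂ} (hν : ν.im ≠ 0) (ha : IsBesselZero ν a)
    (hb : IsBesselZero ν b) : IsBesselRational ν (a / b) :=
  ⟨div_ne_zero (ha.ne_zero hν) (hb.ne_zero hν), a, b, ha, hb, hb.ne_zero hν, rfl⟩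

theorem Set.Finite.exists_pos_le {α : Type*} {S : Set α} (hS : S.Finite) {f : α → ℝ}
    (hf : ∀ x ∈ S, 0 < f x) : ∃ d : ℝ, 0 < d ∧ ∀ x ∈ S, d ≤ f x := by
  have h : ∀ᶠ d in nhdsWithin (0 : ℝ) (Set.Ioi 0), ∀ x ∈ S, d ≤ f x := by
    refine (Filter.eventually_all_finite hS).2 fun x hx => ?_
    filter_upwards [nhdsWithin_le_nhds (Iic_mem_nhds (hf x hx))] with d hd using hd
  obtain ⟨d, hd, hd0⟩ := (h.and self_mem_nhdsWithin).exists
  exact ⟨d, hd0, hd⟩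

/-! ### Absence of Liouville numbers -/

/-- Approximations of a Liouville number can be taken with arbitrarily large denominators. -/
theorem IsBesselLiouville.exists_norm_mul_sub_le {ν z : ℂ} (hν : ν.im ≠ 0)
    (h : IsBesselLiouville ν z) {R : ℝ} (hR : 1 ≤ R) : ∃ a b : ℂ, IsBesselZero ν a ∧
      IsBesselZero ν b ∧ R < ‖b‖ ∧ ‖z * b - a‖ ≤ 1 / R := by
  have hR0 : 0 < R := by linarith
  set S : Set (ℂ × ℂ) := {a | IsBesselZero ν a ∧ ‖a‖ ≤ (‖z‖ + 1) * R} ×ˢ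
    {b | IsBesselZero ν b ∧ ‖b‖ ≤ R} with hS
  have hSf : S.Finite := (finite_setOf_isBesselZero_norm_le hν _).prod
    (finite_setOf_isBesselZero_norm_le hν _)
  -- Each of the finitely many bounded quotients differs from `z`, so a large exponent `N` excludes
  -- them all.
  have hev : ∀ᶠ N : ℕ in Filter.atTop, ∀ p ∈ S, 1 < ‖p.2‖ → 1 / ‖p.2‖ ^ N ≤ ‖z - p.1 / p.2‖ := by
    refine (Filter.eventually_all_finite hSf).2 fun p hp => ?_
    by_cases hp1 : 1 < ‖p.2‖
    · have hpos : 0 < ‖z - p.1 / p.2‖ := by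
        rw [norm_pos_iff, sub_ne_zero]
        rintro rfl
        exact h.1 (hp.1.1.isBesselRational_div hν hp.2.1)
      have ht : Filter.Tendsto (fun N : ℕ => (1 / ‖p.2‖) ^ N) Filter.atTop (nhds 0) :=
        tendsto_pow_atTop_nhds_zero_of_lt_one (by positivity)
          ((div_lt_one (by linarith)).2 hp1)
      filter_upwards [ht.eventually_le_const hpos] with N hN _
      rwa [one_div_pow] at hN
    · exact Filter.Eventually.of_forall fun N h => absurd h hp1
  -- With `N ≥ 2`, one power of `|b|` remains after clearing the denominator.
  obtain ⟨N, hN, hN2⟩ := (hev.and (Filter.eventually_ge_atTop 2)).exists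
  obtain ⟨a, b, ha, hb, hb1, hab⟩ := h.2 N
  have hb0 : 0 < ‖b‖ := by linarith
  have hbne : b ≠ 0 := norm_pos_iff.1 hb0
  have e : ‖z * b - a‖ = ‖z - a / b‖ * ‖b‖ := by
    rw [← norm_mul, sub_mul, div_mul_cancel₀ _ hbne]
  have h2 : ‖z - a / b‖ ≤ 1 / ‖b‖ ^ 2 :=
    hab.le.trans (one_div_le_one_div_of_le (by positivity) (pow_le_pow_right₀ hb1.le hN2))
  have h3 : ‖z * b - a‖ ≤ 1 / ‖b‖ := by
    rw [e]
    calc _ ≤ 1 / ‖b‖ ^ 2 * ‖b‖ := by gcongr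
      _ = _ := by field_simp
  have hbR : R < ‖b‖ := by
    by_contra! hle
    refine absurd hab (not_lt.2 (hN (a, b) ⟨⟨ha, ?_⟩, hb, hle⟩ hb1))
    have h4 : ‖z * b - a‖ ≤ 1 := h3.trans ((div_le_one hb0).2 hb1.le)
    have h5 := norm_sub_norm_le a (z * b)
    rw [norm_sub_rev, norm_mul] at h5
    have h6 : ‖z‖ * ‖b‖ ≤ ‖z‖ * R := by gcongr
    linarith
  exact ⟨a, b, ha, hb, hbR, h3.trans (one_div_le_one_div_of_le hR0 hbR.le)⟩

theorem not_isBesselLiouville {ν : ℂ} (hν : ν.im ≠ 0) (z : ℂ) : ¬ IsBesselLiouville ν z := by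
  intro h
  set c := Real.pi * |ν.im| with hc
  have hc0 : 0 < c := mul_pos Real.pi_pos (abs_pos.2 hν)
  have hz : z ≠ 0 := by
    rintro rfl
    obtain ⟨d, hd, hdle⟩ := (finite_setOf_isBesselZero_norm_le hν 1).exists_pos_le
      (f := fun a => ‖a‖) (fun a ha => norm_pos_iff.2 (ha.1.ne_zero hν))
    obtain ⟨a, b, ha, -, -, hab⟩ := h.exists_norm_mul_sub_le hν (le_max_left 1 (2 / d))
    rw [zero_mul, zero_sub, norm_neg] at hab
    have h1 : 1 / max 1 (2 / d) ≤ 1 := (div_le_one (by positivity)).2 (le_max_left _ _)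
    have h2 : 1 / max 1 (2 / d) ≤ d / 2 := by
      rw [one_div_le (by positivity) (by positivity), one_div_div]
      exact le_max_right _ _
    linarith [hdle a ⟨ha, hab.trans h1⟩]
  have hz0 : 0 < ‖z‖ := norm_pos_iff.2 hz
  have hlarge : ∀ ε : ℝ, 0 < ε → ∀ T : ℝ, ∃ a b : ℂ, IsBesselZero ν b ∧ T < ‖b‖ ∧
      ‖z * b - a‖ ≤ ε ∧ ‖z * b - a‖ ≤ 1 ∧ |2 * |a.im| - c| < ε ∧ |2 * |b.im| - c| < ε := by
    intro ε hε T
    obtain ⟨R, hR⟩ := exists_abs_two_mul_abs_im_sub_lt hν hε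
    obtain ⟨a, b, ha, hb, hbR, hab⟩ := h.exists_norm_mul_sub_le hν
      (R := max (max 1 (1 / ε)) (max T (max R ((R + 1) / ‖z‖))))
      ((le_max_left _ _).trans (le_max_left _ _))
    have h1 : 1 / max (max 1 (1 / ε)) (max T (max R ((R + 1) / ‖z‖))) ≤ 1 :=
      (div_le_one (by positivity)).2 ((le_max_left _ _).trans (le_max_left _ _))
    have h2 : 1 / max (max 1 (1 / ε)) (max T (max R ((R + 1) / ‖z‖))) ≤ ε :=
      (one_div_le (by positivity) hε).2 ((le_max_right _ _).trans (le_max_left _ _))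
    simp only [max_lt_iff] at hbR
    obtain ⟨-, hT, hbR, hbz⟩ := hbR
    rw [div_lt_iff₀ hz0] at hbz
    refine ⟨a, b, hb, hT, hab.trans h2, hab.trans h1, hR a ha ?_, hR b hb hbR.le⟩
    have h5 := norm_sub_norm_le (z * b) a
    rw [norm_mul] at h5
    linarith
  have him : ∀ a b : ℂ, (z * b - a).im = z.re * b.im + z.im * b.re - a.im := fun a b => by
    simp [Complex.mul_im]
  -- Otherwise `Im z · Re b` would be unbounded while every other term of `Im(zb - a)` stays
  -- bounded.
  have hy : z.im = 0 := by
    by_contra hy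
    have hy0 : 0 < |z.im| := abs_pos.2 hy
    obtain ⟨a, b, -, hT, -, hab, ha, hb⟩ := hlarge c hc0 ((1 + (|z.re| + 1) * c) / |z.im| + c)
    have h1 := (Complex.abs_im_le_norm _).trans hab
    rw [him] at h1
    have ha' : |a.im| ≤ c := by linarith [(abs_lt.1 ha).2]
    have hb' : |b.im| ≤ c := by linarith [(abs_lt.1 hb).2]
    have h2 : |z.im| * |b.re| ≤ 1 + (|z.re| + 1) * c := by
      have e : z.im * b.re = (z.re * b.im + z.im * b.re - a.im) + -(z.re * b.im) + a.im := by ring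
      rw [← abs_mul, e]
      refine (abs_add_three _ _ _).trans ?_
      rw [abs_neg, abs_mul]
      have : |z.re| * |b.im| ≤ |z.re| * c := by gcongr
      linarith
    have h3 : |b.re| ≤ (1 + (|z.re| + 1) * c) / |z.im| := by
      rw [le_div_iff₀ hy0]; linarith
    linarith [Complex.norm_le_abs_re_add_abs_im b]
  have hx : |z.re| = 1 := by
    refine eq_of_abs_sub_le_all fun {η} hη => ?_
    set ε := η * c / (|z.re| + 3) with hε
    have hε0 : 0 < ε := by positivity
    obtain ⟨a, b, -, -, hab, -, ha, hb⟩ := hlarge ε hε0 0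
    have h1 := (Complex.abs_im_le_norm _).trans hab
    rw [him, hy, zero_mul, add_zero] at h1
    have h2 := (abs_abs_sub_abs_le _ _).trans h1
    rw [abs_mul] at h2
    have e : c * (|z.re| - 1) = 2 * (|z.re| * |b.im| - |a.im|) + (2 * |a.im| - c) +
        -(|z.re| * (2 * |b.im| - c)) := by ring
    have h3 : |c * (|z.re| - 1)| ≤ η * c := by
      rw [e]
      refine (abs_add_three _ _ _).trans ?_
      rw [abs_neg, abs_mul, abs_mul, abs_abs, abs_two]
      have h4 : |z.re| * |2 * |b.im| - c| ≤ |z.re| * ε := by gcongr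
      have h5 : η * c = (|z.re| + 3) * ε := by rw [hε]; field_simp
      rw [h5]; linarith
    rw [abs_mul, abs_of_pos hc0, mul_comm] at h3
    exact le_of_mul_le_mul_right h3 hc0
  obtain ⟨-, b, hb, -⟩ := hlarge 1 one_pos 0
  have hb0 := hb.ne_zero hν
  rcases eq_or_eq_neg_of_abs_eq hx with h1 | h1
  · have : z = b / b := by rw [div_self hb0]; exact Complex.ext (by simp [h1]) (by simp [hy])
    exact h.1 (this ▸ hb.isBesselRational_div hν hb)
  · have : z = -b / b := by
      rw [neg_div, div_self hb0]; exact Complex.ext (by simp [h1]) (by simp [hy])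
    exact h.1 (this ▸ hb.neg.isBesselRational_div hν hb)

/-! ### Separation of the scaled zeros -/

theorem exists_pos_le_norm_div_sub_div {ν : ℂ} (hν : ν.im ≠ 0) {r s : ℝ} (hr : 0 < r) (hs : 0 < s)
    (hrs : ¬ IsBesselRational ν ((r : ℂ) / (s : ℂ))) :
    ∃ d : ℝ, 0 < d ∧ ∀ a b : ℂ, IsBesselZero ν a → IsBesselZero ν b →
      d ≤ ‖a / (r : ℂ) - b / (s : ℂ)‖ := by
  have hrC : (r : ℂ) ≠ 0 := Complex.ofReal_ne_zero.2 hr.ne'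
  have hsC : (s : ℂ) ≠ 0 := Complex.ofReal_ne_zero.2 hs.ne'
  by_cases hex : ∃ a, IsBesselZero ν a
  swap
  · exact ⟨1, one_pos, fun a b ha _ => absurd ⟨a, ha⟩ hex⟩
  -- If `r = s`, the quotient is `1 = a/a`, which is rational as soon as a zero exists.
  have hne : 1 / r - 1 / s ≠ 0 := by
    obtain ⟨a, ha⟩ := hex
    intro h
    have h1 : r = s := by field_simp at h; linarith
    refine hrs ?_
    rw [h1, div_self hsC, ← div_self (ha.ne_zero hν)]
    exact ha.isBesselRational_div hν ha
  set c := Real.pi * |ν.im| with hc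
  have hc0 : 0 < c := mul_pos Real.pi_pos (abs_pos.2 hν)
  set D := c * |1 / r - 1 / s| with hD
  have hD0 : 0 < D := mul_pos hc0 (abs_pos.2 hne)
  set ε := D / 2 / (1 / r + 1 / s) with hε
  have hε0 : 0 < ε := by positivity
  obtain ⟨R, hR⟩ := exists_abs_two_mul_abs_im_sub_lt hν hε0
  have hlarge : ∀ a b : ℂ, IsBesselZero ν a → IsBesselZero ν b → R ≤ ‖a‖ → R ≤ ‖b‖ →
      D / 4 ≤ ‖a / (r : ℂ) - b / (s : ℂ)‖ := by
    intro a b ha hb haR hbR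
    have h1 := hR a ha haR
    have h2 := hR b hb hbR
    have h3 := Complex.abs_im_le_norm (a / (r : ℂ) - b / (s : ℂ))
    rw [Complex.sub_im, Complex.div_ofReal_im, Complex.div_ofReal_im] at h3
    have h4 := (abs_abs_sub_abs_le _ _).trans h3
    rw [abs_div, abs_div, abs_of_pos hr, abs_of_pos hs] at h4
    have e : c * (1 / r - 1 / s) = 2 * (|a.im| / r - |b.im| / s) +
        -((2 * |a.im| - c) * (1 / r)) + (2 * |b.im| - c) * (1 / s) := by ring
    have h5 : D ≤ 2 * ‖a / (r : ℂ) - b / (s : ℂ)‖ + ε * (1 / r) + ε * (1 / s) := by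
      calc D = |c * (1 / r - 1 / s)| := by rw [abs_mul, abs_of_pos hc0]
        _ ≤ _ := by
          rw [e]
          refine (abs_add_three _ _ _).trans ?_
          rw [abs_neg, abs_mul, abs_mul, abs_mul, abs_two, abs_of_pos (one_div_pos.2 hr),
            abs_of_pos (one_div_pos.2 hs)]
          gcongr
    have h6 : ε * (1 / r) + ε * (1 / s) = D / 2 := by
      rw [hε]; field_simp
    linarith
  -- Beyond `R'` a zero, once scaled, is at distance at least 1 from every scaled zero of modulus
  -- below `R`.
  set R' := max R (max (s * (R / r + 1)) (r * (R / s + 1))) with hR'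
  have hR1 : R ≤ R' := le_max_left _ _
  have hR2 : s * (R / r + 1) ≤ R' := (le_max_left _ _).trans (le_max_right _ _)
  have hR3 : r * (R / s + 1) ≤ R' := (le_max_right _ _).trans (le_max_right _ _)
  obtain ⟨d, hd, hdle⟩ := ((finite_setOf_isBesselZero_norm_le hν R').prod
    (finite_setOf_isBesselZero_norm_le hν R')).exists_pos_le
    (f := fun p => ‖p.1 / (r : ℂ) - p.2 / (s : ℂ)‖) (fun p hp => by
      rw [norm_pos_iff, sub_ne_zero]
      intro h
      have hb := hp.2.1.ne_zero hν
      refine hrs ?_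
      rw [show (r : ℂ) / s = p.1 / p.2 by
        rw [div_eq_div_iff hrC hsC] at h
        rw [div_eq_div_iff hsC hb]
        linear_combination -h]
      exact hp.1.1.isBesselRational_div hν hp.2.1)
  refine ⟨min d (min (D / 4) 1), by positivity, fun a b ha hb => ?_⟩
  have hna : ‖a / (r : ℂ)‖ = ‖a‖ / r := by
    rw [norm_div, Complex.norm_real, Real.norm_of_nonneg hr.le]
  have hnb : ‖b / (s : ℂ)‖ = ‖b‖ / s := by
    rw [norm_div, Complex.norm_real, Real.norm_of_nonneg hs.le]
  by_cases hbig : R ≤ ‖a‖ ∧ R ≤ ‖b‖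
  · exact (min_le_right _ _).trans ((min_le_left _ _).trans (hlarge a b ha hb hbig.1 hbig.2))
  by_cases hsmall : ‖a‖ ≤ R' ∧ ‖b‖ ≤ R'
  · exact (min_le_left _ _).trans (hdle (a, b) ⟨⟨ha, hsmall.1⟩, hb, hsmall.2⟩)
  refine (min_le_right _ _).trans ((min_le_right _ _).trans ?_)
  rcases lt_or_ge ‖a‖ R with h1 | h1
  · have h2 : R' < ‖b‖ := by
      by_contra! h
      exact hsmall ⟨h1.le.trans hR1, h⟩
    have h3 := norm_sub_norm_le (b / (s : ℂ)) (a / (r : ℂ))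
    rw [norm_sub_rev, hna, hnb] at h3
    have h4 : R / r + 1 ≤ ‖b‖ / s := by
      rw [le_div_iff₀ hs]; linarith
    have h5 : ‖a‖ / r ≤ R / r := by gcongr
    linarith
  · have hb1 : ‖b‖ < R := by
      by_contra! h
      exact hbig ⟨h1, h⟩
    have h2 : R' < ‖a‖ := by
      by_contra! h
      exact hsmall ⟨h, hb1.le.trans hR1⟩
    have h3 := norm_sub_norm_le (a / (r : ℂ)) (b / (s : ℂ))
    rw [hna, hnb] at h3
    have h4 : R / s + 1 ≤ ‖a‖ / r := by
      rw [le_div_iff₀ hr]; linarith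
    have h5 : ‖b‖ / s ≤ R / s := by gcongr
    linarith

theorem corollaryT (ν : ℂ) (hν : ν.im ≠ 0) :
    (∀ z : ℂ, ¬ IsBesselLiouville ν z) ∧
    (∀ r s : ℝ, 0 < r → 0 < s → ¬ IsBesselRational ν ((r : ℂ) / (s : ℂ)) →
      ∃ d : ℝ, 0 < d ∧ ∀ a b : ℂ, IsBesselZero ν a → IsBesselZero ν b →
        d ≤ ‖a / (r : ℂ) - b / (s : ℂ)‖) :=
  ⟨not_isBesselLiouville hν, fun _ _ hr hs h => exists_pos_le_norm_div_sub_div hν hr hs h⟩
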